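/- **Proposition.** Let $(R,\mathfrak m)$ be a Noetherian local ring of dimension $d\ge 1$ with infinite residue field, let $s\ge 2$, and let $\mathbf I=(I_1,\dots,I_s)$ be $\mathfrak m$-primary ideals of $R$. Order $\mathbb Z^s$ componentwise, and for $\mathbf n\in\mathbb Z^s$ put $\mathbf I^{\mathbf n}=I_1^{n_1}\cdots I_s^{n_s}$ (powers with negative exponent being $R$) and $\mathbf n^+=(\max\{0,n_1\},\dots,\max\{0,n_s\})$. Let $\mathcal F=\{\mathcal F(\mathbf n)\}_{\mathbf n\in\mathbb Z^s}$ be an $\mathbf I$-admissible filtration of ideals of $R$, that is: for all $\mathbf m,\mathbf n\in\mathbb Z^s$, 1. $\mathbf I^{\mathbf n}\subseteq\mathcal F(\mathbf n)$; 2. $\mathcal F(\mathbf n)\mathcal F(\mathbf m)\subseteq\mathcal F(\mathbf n+\mathbf m)$; 3. $\mathcal F(\mathbf m)\subseteq\mathcal F(\mathbf n)$ whenever $\mathbf m\ge\mathbf n$; 4. $\mathcal F(\mathbf n)=\mathcal F(\mathbf n^+)$; and, with $t_1,\dots,t_s$ indeterminates, $\bigoplus_{\mathbf n\in\mathbb Z^s}\mathcal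 F(\mathbf n)\,\mathbf t^{\mathbf n}$ is a finite module over the extended Rees ring $\bigoplus_{\mathbf n\in\mathbb Z^s}\mathbf I^{\mathbf n}\,\mathbf t^{\mathbf n}$. Let $H_{\mathcal F}(\mathbf n)=\lambda_R(R/\mathcal F(\mathbf n))$ be the Hilbert function of $\mathcal F$ ($\lambda_R$ denoting length), and let $P_{\mathcal F}\in\mathbb Q[X_1,\dots,X_s]$ be the Hilbert polynomial of $\mathcal F$, i.e. the polynomial with $P_{\mathcal F}(\mathbf n)=H_{\mathcal F}(\mathbf n)$ whenever all coordinates of $\mathbf n$ are sufficiently large. A vector $\mathbf n\in\mathbb Z^s$ is called a postulation vector of $\mathcal F$ if $H_{\mathcal F}(\mathbf m)=P_{\mathcal F}(\mathbf m)$ for all $\mathbf m\in\mathbb Z^s$ with $\mathbf m\ge\mathbf n$; let $\mathcal P(\mathcal F)$ be the set of postulation vectors of $\mathcal F$. Then $\mathcal P(\mathcal F)\subseteq\mathbb N^s$, where $\mathbb N=\{0,1,2,\dots\}$; that is, every postulation vector of $\mathcal F$ has only nonnegative coordinates. -/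

import Mathlib

namespace MultiFiltration

variable {R : Type*} [CommRing R] {s : ℕ}

/-- An ideal of a local ring `(R, 𝔪)` is `𝔪`-primary. -/
def IsMaxPrimary [IsLocalRing R] (J : Ideal R) : Prop :=
  J.IsPrimary ∧ J.radical = IsLocalRing.maximalIdeal R

/-- `I^n = I₁^{n₁} ⋯ I_s^{n_s}` for `n ∈ ℤ^s`, with the usual convention that a power of an ideal
with negative exponent is `R`. -/
def mpow (I : Fin s → Ideal R) (n : Fin s → ℤ) : Ideal R :=
  ∏ i, I i ^ (n i).toNat

/-- A `ℤ^s`-graded `I`-filtration. The order on `ℤ^s` is componentwise. -/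
structure IsFiltration (I : Fin s → Ideal R) (F : (Fin s → ℤ) → Ideal R) : Prop where
  mpow_le : ∀ n, mpow I n ≤ F n
  mul_le : ∀ m n, F n * F m ≤ F (n + m)
  anti : ∀ m n, n ≤ m → F m ≤ F n

theorem mpow_zero (I : Fin s → Ideal R) : mpow I 0 = ⊤ := by
  simp [mpow]

theorem mpow_mul_le (I : Fin s → Ideal R) (m n : Fin s → ℤ) :
    mpow I m * mpow I n ≤ mpow I (m + n) := by
  unfold mpow
  rw [← Finset.prod_mul_distrib]
  refine Finset.prod_le_prod' fun i _ => ?_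
  rw [← pow_add]
  refine Ideal.pow_le_pow_right ?_
  simp only [Pi.add_apply]
  omega

/-- If all coefficients of `f` and `g` lie in the families of ideals `A` and `B`, and
`A a * B b ≤ C (a + b)`, then all coefficients of `f * g` lie in `C`. -/
theorem coeff_mul_mem {A B C : (Fin s → ℤ) → Ideal R}
    (h : ∀ a b, A a * B b ≤ C (a + b)) {f g : AddMonoidAlgebra R (Fin s → ℤ)}
    (hf : ∀ n, f.coeff n ∈ A n) (hg : ∀ n, g.coeff n ∈ B n) (n : Fin s → ℤ) :
    (f * g).coeff n ∈ C n := by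
  classical
  rw [AddMonoidAlgebra.coeff_mul]
  refine Ideal.sum_mem _ fun a _ => Ideal.sum_mem _ fun b _ => ?_
  dsimp only
  split_ifs with hab
  · rw [← hab]
    exact h a b (Ideal.mul_mem_mul (hf a) (hg b))
  · exact Ideal.zero_mem _

/-- The extended Rees ring `R'(I) = ⨁_{n ∈ ℤ^s} I^n t^n`, as a subalgebra of the Laurent polynomial
ring `R[t₁^{±1}, …, t_s^{±1}]`. -/
def extendedRees (I : Fin s → Ideal R) : Subalgebra R (AddMonoidAlgebra R (Fin s → ℤ)) where
  carrier := {f | ∀ n, f.coeff n ∈ mpow I n}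
  mul_mem' hf hg := coeff_mul_mem (mpow_mul_le I) hf hg
  add_mem' hf hg n := (mpow I n).add_mem (hf n) (hg n)
  algebraMap_mem' r n := by
    classical
    by_cases h : n = 0
    · subst h
      rw [mpow_zero]
      trivial
    · simp [AddMonoidAlgebra.coe_algebraMap, Ne.symm h]

/-- The extended Rees module `R'(F) = ⨁_{n ∈ ℤ^s} F(n) t^n` of an `I`-filtration `F`,
with its structure of a module over `R'(I)`. -/
def extendedReesModule {I : Fin s → Ideal R} {F : (Fin s → ℤ) → Ideal R}
    (h : IsFiltration I F) : Submodule (extendedRees I) (AddMonoidAlgebra R (Fin s → ℤ)) where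
  carrier := {f | ∀ n, f.coeff n ∈ F n}
  zero_mem' n := (F n).zero_mem
  add_mem' hf hg n := (F n).add_mem (hf n) (hg n)
  smul_mem' c _ hg := coeff_mul_mem
    (fun a b => (Ideal.mul_mono_left (h.mpow_le a)).trans (h.mul_le b a)) c.2 hg

/-- An `I`-admissible filtration: an `I`-filtration `F` with `F(n) = F(n⁺)` for all `n`, such that
`R'(F)` is a finite `R'(I)`-module. -/
structure IsAdmissible (I : Fin s → Ideal R) (F : (Fin s → ℤ) → Ideal R) : Prop
    extends IsFiltration I F where
  eq_pos : ∀ n, F n = F (fun i => max 0 (n i))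
  finite : Module.Finite (extendedRees I) (extendedReesModule toIsFiltration)

/-- The Hilbert function `H_F(n) = λ(R / F(n))`. The length is finite for an `I`-filtration with
`I₁, …, I_s` primary to the maximal ideal of a Noetherian local ring. -/
noncomputable def hilbertFunction (F : (Fin s → ℤ) → Ideal R) (n : Fin s → ℤ) : ℕ :=
  (Module.length R (R ⧸ F n)).toNat

/-- `P` is the Hilbert polynomial of `F`: `P(n) = H_F(n)` for all large `n`.
This determines `P` uniquely. -/
def IsHilbertPolynomial (F : (Fin s → ℤ) → Ideal R) (P : MvPolynomial (Fin s) ℚ) : Prop :=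
  ∃ N : Fin s → ℤ, ∀ n, N ≤ n →
    MvPolynomial.eval (fun i => (n i : ℚ)) P = (hilbertFunction F n : ℚ)

/-- The set of postulation vectors of `F`: those `n ∈ ℤ^s` such that `H_F(m) = P_F(m)` for all
`m ≥ n`, where `P_F` is the Hilbert polynomial of `F`. -/
def postulationVectors (F : (Fin s → ℤ) → Ideal R) : Set (Fin s → ℤ) :=
  {n | ∃ P : MvPolynomial (Fin s) ℚ, IsHilbertPolynomial F P ∧
    ∀ m, n ≤ m → (hilbertFunction F m : ℚ) = MvPolynomial.eval (fun i => (m i : ℚ)) P}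

end MultiFiltration

/-! ### Growth of bivariate polynomials over ℚ. -/

namespace Polynomial

open Filter

/-! Suppose `n` is a postulation vector with `n i < 0`. Pick `j ≠ i` and freeze the other
coordinates: the Hilbert function is then a polynomial `Q(x, t)` for `x ≥ -1` and large `t`. Since
`F(n) = F(n⁺)`, `Q(-1, T) = Q(0, T)`.

Finiteness of the Rees module gives `F(m + a e_k) ⊆ I_k^a F(m)` once `m_k ≥ r`
(`exists_le_pow_mul`). With `I_j^b ⊆ I_i` and `I_i^a ⊆ I_j` this yields `Q(x, t) ≤ Q(0, t + bx)` and
`Q(r, t + 1) ≤ Q(r + a, t)`.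

If `Q(0, T)` had degree `D + 1 > 0`, the first bound would force total degree at most `D + 1`. The
coefficient of `T^D` is then linear in `X` with equal values at `-1` and `0`, hence constant, and
the second bound fails (`natDegree_eq_zero_of_growth`). So `Q(0, T)` is constant, and Nakayama gives
dimension zero (`ringKrullDim_eq_zero`), a contradiction. -/

theorem leadingCoeff_nonneg_of_eval_natCast_nonneg {p : ℚ[X]} {N : ℕ}
    (h : ∀ t : ℕ, N ≤ t → 0 ≤ p.eval (t : ℚ)) : 0 ≤ p.leadingCoeff := by
  by_contra! hneg
  rcases Nat.eq_zero_or_pos p.natDegree with h0 | hpos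
  · rw [eq_C_of_natDegree_eq_zero h0] at h hneg
    have := h N le_rfl
    simp at this hneg
    linarith
  · have ht := (p.tendsto_atBot_of_leadingCoeff_nonpos (natDegree_pos_iff_degree_pos.1 hpos)
      hneg.le).comp (tendsto_natCast_atTop_atTop (R := ℚ))
    obtain ⟨t, ht1, ht2⟩ := ((ht.eventually_lt_atBot 0).and (eventually_ge_atTop N)).exists
    exact absurd (h t ht2) (not_le.2 ht1)

theorem natDegree_le_of_eval_natCast_le {p q : ℚ[X]} {N : ℕ}
    (h0 : ∀ t : ℕ, N ≤ t → 0 ≤ p.eval (t : ℚ))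
    (h : ∀ t : ℕ, N ≤ t → p.eval (t : ℚ) ≤ q.eval (t : ℚ)) : p.natDegree ≤ q.natDegree := by
  by_contra! hlt
  have h1 := leadingCoeff_nonneg_of_eval_natCast_nonneg h0
  have h2 := leadingCoeff_nonneg_of_eval_natCast_nonneg (p := q - p) (N := N)
    fun t ht => by simpa using h t ht
  rw [leadingCoeff_sub_of_degree_lt' (degree_lt_degree hlt)] at h2
  have : p = 0 := leadingCoeff_eq_zero.1 (by linarith)
  simp [this] at hlt

theorem eq_of_eval_natCast_eq {p q : ℚ[X]} {N : ℕ}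
    (h : ∀ t : ℕ, N ≤ t → p.eval (t : ℚ) = q.eval (t : ℚ)) : p = q := by
  refine eq_of_infinite_eval_eq p q (Set.Infinite.mono (s := (Nat.cast '' Set.Ici N)) ?_
    ((Set.Ici_infinite N).image Nat.cast_injective.injOn))
  rintro _ ⟨t, ht, rfl⟩
  exact h t ht

/-- By Taylor expansion, the coefficient is the value at 1 of the `D`-th Hasse derivative, which is
linear here. -/
theorem coeff_comp_X_add_one_sub {p : ℚ[X]} {D : ℕ} (hp : p.natDegree ≤ D + 1) :
    (p.comp (X + 1)).coeff D = p.coeff D + (D + 1) * p.coeff (D + 1) := by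
  have h1 : p.comp (X + 1) = taylor 1 p := by simp [taylor_apply]
  have h2 : (hasseDeriv D p).natDegree < 2 := by
    have := natDegree_hasseDeriv_le p D
    omega
  rw [h1, taylor_coeff, eval_eq_sum_range' h2]
  simp [Finset.sum_range_succ, hasseDeriv_coeff, add_comm 1 D]

/-- `Q(kT, T)` for a bivariate polynomial `Q`. -/
noncomputable def diag (Q : ℚ[X][X]) (k : ℚ) : ℚ[X] :=
  Q.eval₂ (compRingHom (C k * X)) X

theorem eval_diag (Q : ℚ[X][X]) (k t : ℚ) :
    (diag Q k).eval t = (Q.map (evalRingHom (k * t))).eval t := by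
  rw [diag, eval_map, ← coe_evalRingHom, hom_eval₂, coe_evalRingHom, eval_X]
  congr 1
  ext <;> simp

theorem coeff_diag (Q : ℚ[X][X]) (k : ℚ) (m : ℕ) :
    (diag Q k).coeff m =
      ∑ i ∈ Finset.range (m + 1), (Q.coeff (m - i)).coeff i * k ^ i := by
  rw [diag, eval₂_eq_sum_range' _ (n := max (Q.natDegree + 1) (m + 1)) (by omega), finsetSum_coeff]
  simp only [coe_compRingHom_apply, coeff_mul_X_pow', comp_C_mul_X_coeff]
  rw [← Finset.sum_filter, ← Finset.sum_range_reflect]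
  have : Finset.filter (fun x => x ≤ m) (Finset.range (max (Q.natDegree + 1) (m + 1)))
      = Finset.range (m + 1) := by
    ext; simp; omega
  rw [this]
  refine Finset.sum_congr rfl fun i hi => ?_
  rw [Finset.mem_range, Nat.lt_succ_iff] at hi
  simp [Nat.sub_sub_self hi]

/-- The degree `i + j` coefficient of `Q(kT, T)` is a polynomial in `k` whose coefficients are those
of the homogeneous part of `Q`. It vanishes at every natural `k`, hence identically. -/
theorem coeff_coeff_eq_zero_of_natDegree_diag_le {Q : ℚ[X][X]} {D : ℕ}
    (h : ∀ k : ℕ, (diag Q k).natDegree ≤ D) {i j : ℕ} (hij : D < i + j) :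
    (Q.coeff j).coeff i = 0 := by
  set m := i + j with hm
  let p : ℚ[X] := ∑ l ∈ Finset.range (m + 1), C ((Q.coeff (m - l)).coeff l) * X ^ l
  have hp : p = 0 := eq_of_eval_natCast_eq (N := 0) fun k _ => by
    have := coeff_diag Q k m
    rw [coeff_eq_zero_of_natDegree_lt ((h k).trans_lt hij)] at this
    simp [p, eval_finsetSum, ← this]
  have := congrArg (fun q => coeff q i) hp
  simpa [p, finsetSum_coeff, coeff_C_mul, coeff_X_pow, show i < m + 1 by omega,
    show m - i = j by omega] using this

/-- A numerical obstruction for a bivariate polynomial: growth in the first variable which is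
controlled by, and controls, growth in the second variable forces `Q(0, T) ≠ Q(-1, T)`,
unless `Q(0, T)` is constant. -/
theorem natDegree_eq_zero_of_growth {Q : ℚ[X][X]} {N a b r : ℕ}
    (hconst : ∀ t : ℕ, N ≤ t →
      (Q.map (evalRingHom (-1))).eval (t : ℚ) = (Q.map (evalRingHom 0)).eval (t : ℚ))
    (hnonneg : ∀ x t : ℕ, N ≤ t → 0 ≤ (Q.map (evalRingHom (x : ℚ))).eval (t : ℚ))
    (hupper : ∀ x t : ℕ, N ≤ t → (Q.map (evalRingHom (x : ℚ))).eval (t : ℚ) ≤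
      (Q.map (evalRingHom 0)).eval ((t + b * x : ℕ) : ℚ))
    (hlower : ∀ t : ℕ, N ≤ t → (Q.map (evalRingHom (r : ℚ))).eval ((t + 1 : ℕ) : ℚ) ≤
      (Q.map (evalRingHom ((r + a : ℕ) : ℚ))).eval (t : ℚ)) :
    (Q.map (evalRingHom 0)).natDegree = 0 := by
  set q := Q.map (evalRingHom 0) with hq
  by_contra hD
  obtain ⟨D, hD⟩ := Nat.exists_eq_succ_of_ne_zero hD
  -- Put `x = kt` in `hupper`: `Q(kt, t) ≤ q((1 + bk)t)`.
  have hdiag (k : ℕ) : (diag Q k).natDegree ≤ D + 1 := by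
    have h1 : (diag Q k).natDegree ≤ (q.comp (C ((1 + b * k : ℕ) : ℚ) * X)).natDegree := by
      refine natDegree_le_of_eval_natCast_le (N := N) (fun t ht => ?_) fun t ht => ?_
      · rw [eval_diag]
        exact_mod_cast hnonneg (k * t) t ht
      · rw [eval_diag, eval_comp]
        have := hupper (k * t) t ht
        simp only [eval_mul, eval_C, eval_X]
        convert this using 2
        · push_cast; rfl
        · push_cast; ring
    refine h1.trans (natDegree_comp_le.trans ?_)
    have : (C ((1 + b * k : ℕ) : ℚ) * X).natDegree ≤ 1 := (natDegree_C_mul_le _ _).trans natDegree_X_le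
    rw [hD]
    nlinarith
  have hzero {i j : ℕ} (hij : D + 1 < i + j) : (Q.coeff j).coeff i = 0 :=
    coeff_coeff_eq_zero_of_natDegree_diag_le hdiag hij
  have hdeg (x : ℚ) : (Q.map (evalRingHom x)).natDegree ≤ D + 1 := by
    refine natDegree_le_iff_coeff_eq_zero.2 fun j hj => ?_
    have : Q.coeff j = 0 := ext fun i => by simpa using hzero (by omega)
    simp [coeff_map, this]
  have htop (x : ℚ) : (Q.map (evalRingHom x)).coeff (D + 1) = q.coeff (D + 1) := by
    have : Q.coeff (D + 1) = C ((Q.coeff (D + 1)).coeff 0) :=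
      eq_C_of_natDegree_le_zero (natDegree_le_iff_coeff_eq_zero.2 fun i hi => hzero (by omega))
    rw [hq, coeff_map, coeff_map, this]
    simp
  -- The total degree bound makes this coefficient linear in `x`; equality at `-1` and `0` kills its
  -- slope.
  have hsub (x : ℚ) : (Q.map (evalRingHom x)).coeff D = q.coeff D := by
    have h1 : (Q.coeff D).natDegree ≤ 1 :=
      natDegree_le_iff_coeff_eq_zero.2 fun i hi => hzero (by omega)
    have h2 : (Q.map (evalRingHom (-1))).coeff D = q.coeff D := by
      rw [eq_of_eval_natCast_eq hconst]
    rw [hq, coeff_map, coeff_map, eq_X_add_C_of_natDegree_le_one h1] at *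
    simp at h2 ⊢
    simp [h2]
  set p := Q.map (evalRingHom (r : ℚ)) with hp
  set p' := Q.map (evalRingHom ((r + a : ℕ) : ℚ)) with hp'
  have hlead : 0 < q.coeff (D + 1) := by
    rw [← Nat.succ_eq_add_one, ← hD]
    refine lt_of_le_of_ne ?_ ?_
    · exact leadingCoeff_nonneg_of_eval_natCast_nonneg (N := N) fun t ht => by
        simpa only [Nat.cast_zero] using hnonneg 0 t ht
    · rw [coeff_natDegree, ne_comm, Ne, leadingCoeff_eq_zero]
      rintro h
      simp [h] at hD
  -- The top two coefficients of `p` and `p'` agree, so only the contribution of the shift `T ↦ T +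
  -- 1` survives.
  have hcoeff : (p' - p.comp (X + 1)).coeff D = - ((D + 1) * q.coeff (D + 1)) := by
    rw [coeff_sub, coeff_comp_X_add_one_sub (hdeg _), hsub (r + a : ℕ), hsub r, htop r]
    ring
  have hneg : (p' - p.comp (X + 1)).coeff D < 0 := by
    rw [hcoeff]
    have : (0 : ℚ) < (D + 1) * q.coeff (D + 1) := by positivity
    linarith
  have hle : (p' - p.comp (X + 1)).natDegree ≤ D := by
    refine natDegree_le_iff_coeff_eq_zero.2 fun j hj => ?_
    rcases Nat.lt_or_ge (D + 1) j with h | h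
    · rw [coeff_sub, coeff_eq_zero_of_natDegree_lt ((hdeg _).trans_lt h),
        coeff_eq_zero_of_natDegree_lt, sub_zero]
      refine lt_of_le_of_lt (natDegree_comp_le.trans ?_) h
      have : (X + 1 : ℚ[X]).natDegree = 1 := natDegree_X_add_C 1
      rw [this, mul_one]
      exact hdeg _
    · obtain rfl : j = D + 1 := by omega
      rw [coeff_sub, htop (r + a : ℕ), coeff_comp_X_add_one_sub ((hdeg _).trans (Nat.le_succ _)),
        htop r,
        coeff_eq_zero_of_natDegree_lt (lt_of_le_of_lt (hdeg _) (Nat.lt_succ_self _))]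
      ring
  have heq : (p' - p.comp (X + 1)).natDegree = D :=
    le_antisymm hle (le_natDegree_of_ne_zero hneg.ne)
  have := leadingCoeff_nonneg_of_eval_natCast_nonneg (p := p' - p.comp (X + 1)) (N := N)
    fun t ht => by
      have := hlower t ht
      push_cast at this
      simpa [eval_comp] using this
  rw [leadingCoeff, heq] at this
  linarith

end Polynomial

/-! ### Absorbing powers of `I k` through finiteness of the Rees module. -/

namespace MultiFiltration

variable {R : Type*} [CommRing R] {s : ℕ}

theorem mpow_single (I : Fin s → Ideal R) (k : Fin s) (a : ℕ) :
    mpow I (Pi.single k (a : ℤ)) = I k ^ a := by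
  rw [mpow, Finset.prod_eq_single k]
  · simp
  · intro l _ hl
    simp [hl]
  · simp

theorem mpow_le_mul_mpow_sub_single (I : Fin s → Ideal R) {n : Fin s → ℤ} {k : Fin s}
    (hk : 0 < n k) : mpow I n ≤ I k * mpow I (n - Pi.single k 1) := by
  have hsplit (m : Fin s → ℤ) :
      mpow I m = I k ^ (m k).toNat * ∏ i ∈ Finset.univ.erase k, I i ^ (m i).toNat :=
    (Finset.mul_prod_erase _ (fun i => I i ^ (m i).toNat) (Finset.mem_univ k)).symm
  rw [hsplit n, hsplit (n - _), ← mul_assoc, ← pow_succ']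
  refine Ideal.mul_mono (Ideal.pow_le_pow_right ?_) (le_of_eq (Finset.prod_congr rfl fun i hi => ?_))
  · simp
    omega
  · simp [Finset.ne_of_mem_erase hi]

namespace IsFiltration

variable {I : Fin s → Ideal R} {F : (Fin s → ℤ) → Ideal R} (h : IsFiltration I F)
include h

theorem pow_mul_le (k : Fin s) (a : ℕ) (n : Fin s → ℤ) :
    I k ^ a * F n ≤ F (n + Pi.single k (a : ℤ)) := by
  rw [mul_comm, ← mpow_single]
  exact (Ideal.mul_mono_right (h.mpow_le _)).trans (h.mul_le _ _)

/-- When the generators have `k`-degree at most `r`, reaching a larger `k`-degree needs a Rees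
coefficient of positive `k`-degree, from which one factor `I k` splits off. -/
theorem coeff_mem_of_mem_span {r : ℤ} {k : Fin s}
    {S : Set (AddMonoidAlgebra R (Fin s → ℤ))} (hS : ∀ f ∈ S, ∀ n, f.coeff n ∈ F n)
    (hr : ∀ f ∈ S, ∀ n, r < n k → f.coeff n = 0)
    {f : AddMonoidAlgebra R (Fin s → ℤ)} (hf : f ∈ Submodule.span (extendedRees I) S)
    {n : Fin s → ℤ} (hn : r < n k) : f.coeff n ∈ I k * F (n - Pi.single k 1) := by
  classical
  -- `G` encodes the claim as a graded family stable under the Rees algebra, so span induction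
  -- applies.
  let G : (Fin s → ℤ) → Ideal R := fun n => if r < n k then I k * F (n - Pi.single k 1) else F n
  have hG (n : Fin s → ℤ) : G n ≤ F n := by
    simp only [G]
    split_ifs
    · have := h.pow_mul_le k 1 (n - Pi.single k 1)
      rwa [pow_one, Nat.cast_one, sub_add_cancel] at this
    · exact le_rfl
  have hmul (a b : Fin s → ℤ) : mpow I a * G b ≤ G (a + b) := by
    have hFF (a b : Fin s → ℤ) : mpow I a * F b ≤ F (a + b) :=
      (Ideal.mul_mono_left (h.mpow_le a)).trans (h.mul_le b a)
    by_cases hab : r < (a + b) k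
    · simp only [G, if_pos hab]
      by_cases hb : r < b k
      · rw [if_pos hb, mul_left_comm, add_sub_assoc]
        exact Ideal.mul_mono_right (hFF _ _)
      -- Here `b k ≤ r < a k + b k`, so `a k > 0` and the factor `I k` comes from `mpow I a`.
      · rw [if_neg hb]
        refine (Ideal.mul_mono_left (mpow_le_mul_mpow_sub_single I (k := k) ?_)).trans ?_
        · simp only [Pi.add_apply] at hab
          omega
        · rw [mul_assoc, add_sub_right_comm]
          exact Ideal.mul_mono_right (hFF _ _)
    · refine (Ideal.mul_mono_right (hG b)).trans ((hFF a b).trans ?_)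
      simp only [G, if_neg hab, le_refl]
  have key : ∀ n, f.coeff n ∈ G n := by
    induction hf using Submodule.span_induction with
    | mem f hf =>
      intro n
      by_cases hn : r < n k
      · rw [hr f hf n hn]
        exact zero_mem _
      · simp only [G, if_neg hn]
        exact hS f hf n
    | zero => exact fun n => (G n).zero_mem
    | add f g _ _ hf hg => exact fun n => (G n).add_mem (hf n) (hg n)
    | smul c f _ hf => exact coeff_mul_mem hmul c.2 hf
  simpa only [G, if_pos hn] using key n

end IsFiltration

namespace IsAdmissible

variable {I : Fin s → Ideal R} {F : (Fin s → ℤ) → Ideal R} (h : IsAdmissible I F)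
include h

theorem exists_le_mul : ∃ r : ℕ, ∀ (k : Fin s) (n : Fin s → ℤ), (r : ℤ) ≤ n k →
    F (n + Pi.single k 1) ≤ I k * F n := by
  classical
  obtain ⟨S, hS⟩ := Module.Finite.iff_fg.1 h.finite
  -- A bound for every exponent, in every direction, occurring in the generators.
  let r : ℕ := S.sup fun f => f.coeff.support.sup fun n => Finset.univ.sup fun k => (n k).toNat
  refine ⟨r, fun k n hn z hz => ?_⟩
  have hmem : AddMonoidAlgebra.single (n + Pi.single k 1) z ∈
      Submodule.span (extendedRees I) (S : Set (AddMonoidAlgebra R (Fin s → ℤ))) := by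
    rw [hS]
    intro m
    by_cases hm : n + Pi.single k 1 = m
    · subst hm
      simpa using hz
    · simp [hm]
  have := h.toIsFiltration.coeff_mem_of_mem_span (r := r) (k := k) (n := n + Pi.single k 1)
    (fun f hf m => ?_) (fun f hf m hm => ?_) hmem ?_
  · simpa using this
  · have hf' : f ∈ extendedReesModule h.toIsFiltration := hS ▸ Submodule.subset_span hf
    exact hf' m
  · by_contra hne
    have h1 : (m k).toNat ≤ r :=
      (Finset.le_sup (f := fun k => (m k).toNat) (Finset.mem_univ k)).trans <|
      (Finset.le_sup (f := fun n : Fin s → ℤ => Finset.univ.sup fun k => (n k).toNat)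
        (Finsupp.mem_support_iff.2 hne)).trans <|
      Finset.le_sup (f := fun f : AddMonoidAlgebra R (Fin s → ℤ) =>
        f.coeff.support.sup fun n => Finset.univ.sup fun k => (n k).toNat) hf
    omega
  · simp
    omega

theorem exists_le_pow_mul : ∃ r : ℕ, ∀ (k : Fin s) (n : Fin s → ℤ), (r : ℤ) ≤ n k →
    ∀ a : ℕ, F (n + Pi.single k (a : ℤ)) ≤ I k ^ a * F n := by
  obtain ⟨r, hr⟩ := h.exists_le_mul
  refine ⟨r, fun k n hn a => ?_⟩
  induction a with
  | zero => simp
  | succ a ih =>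
    have := hr k (n + Pi.single k (a : ℤ)) (by simp; omega)
    rw [add_assoc, ← Pi.single_add] at this
    push_cast
    rw [pow_succ', mul_assoc]
    exact this.trans (Ideal.mul_mono_right ih)

end IsAdmissible

/-! ### Finite colengths and Nakayama's lemma. -/

section Length

open IsLocalRing

variable [IsLocalRing R]

theorem IsMaxPrimary.le_maximalIdeal {J : Ideal R} (hJ : IsMaxPrimary J) : J ≤ maximalIdeal R :=
  Ideal.le_radical.trans hJ.2.le

variable [IsNoetherianRing R] {I : Fin s → Ideal R} {F : (Fin s → ℤ) → Ideal R}

theorem IsMaxPrimary.exists_pow_le {J : Ideal R} (hJ : IsMaxPrimary J) :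
    ∃ k, maximalIdeal R ^ k ≤ J :=
  Ideal.exists_pow_le_of_le_radical_of_fg hJ.2.ge (IsNoetherian.noetherian _)

theorem IsMaxPrimary.exists_pow_le_of_isMaxPrimary {J K : Ideal R} (hJ : IsMaxPrimary J)
    (hK : IsMaxPrimary K) : ∃ k, J ^ k ≤ K :=
  let ⟨k, hk⟩ := hK.exists_pow_le
  ⟨k, (Ideal.pow_right_mono hJ.le_maximalIdeal k).trans hk⟩

theorem exists_pow_le_mpow (hI : ∀ i, IsMaxPrimary (I i)) (n : Fin s → ℤ) :
    ∃ k, maximalIdeal R ^ k ≤ mpow I n := by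
  choose k hk using fun i => (hI i).exists_pow_le
  refine ⟨∑ i, k i * (n i).toNat, ?_⟩
  rw [← Finset.prod_pow_eq_pow_sum, mpow]
  refine Finset.prod_le_prod' fun i _ => ?_
  rw [pow_mul]
  exact Ideal.pow_right_mono (hk i) _

theorem isFiniteLength_quotient_of_pow_le {J : Ideal R} {k : ℕ} (hk : maximalIdeal R ^ k ≤ J) :
    IsFiniteLength R (R ⧸ J) := by
  rcases eq_or_ne J ⊤ with rfl | hJ
  · exact .of_subsingleton
  have : Nontrivial (R ⧸ J) := Ideal.Quotient.nontrivial_iff.2 hJ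
  have : IsLocalRing (R ⧸ J) := .of_surjective' _ Ideal.Quotient.mk_surjective
  have hnil : IsNilpotent (maximalIdeal (R ⧸ J)) := by
    refine ⟨k, ?_⟩
    have hmap : maximalIdeal (R ⧸ J) = (maximalIdeal R).map (Ideal.Quotient.mk J) :=
      (IsLocalRing.map_maximalIdeal_of_surjective _ Ideal.Quotient.mk_surjective).symm
    rw [hmap, ← Ideal.map_pow, Ideal.zero_eq_bot, Ideal.map_eq_bot_iff_le_ker, Ideal.mk_ker]
    exact hk
  have : IsArtinianRing (R ⧸ J) := (isArtinianRing_iff_isNilpotent_maximalIdeal _).2 hnil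
  rw [isFiniteLength_iff_isNoetherian_isArtinian]
  exact ⟨inferInstance, isArtinian_of_surjective_algebraMap (Ideal.Quotient.mk_surjective (I := J))⟩

theorem IsFiltration.coheight_lt_top (h : IsFiltration I F) (hI : ∀ i, IsMaxPrimary (I i))
    (n : Fin s → ℤ) : Order.coheight (F n) < ⊤ := by
  obtain ⟨k, hk⟩ := exists_pow_le_mpow hI n
  rw [← Module.length_quotient, lt_top_iff_ne_top, Module.length_ne_top_iff]
  exact isFiniteLength_quotient_of_pow_le (hk.trans (h.mpow_le n))

theorem IsFiltration.hilbertFunction_mono (h : IsFiltration I F) (hI : ∀ i, IsMaxPrimary (I i))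
    {m n : Fin s → ℤ} (hmn : F n ≤ F m) : hilbertFunction F m ≤ hilbertFunction F n := by
  rw [hilbertFunction, hilbertFunction, Module.length_quotient, Module.length_quotient]
  exact ENat.toNat_le_toNat (Order.coheight_anti hmn) (h.coheight_lt_top hI n).ne

theorem IsFiltration.eq_of_hilbertFunction_eq (h : IsFiltration I F)
    (hI : ∀ i, IsMaxPrimary (I i)) {m n : Fin s → ℤ} (hmn : F n ≤ F m)
    (heq : hilbertFunction F m = hilbertFunction F n) : F n = F m := by
  rw [hilbertFunction, hilbertFunction, Module.length_quotient, Module.length_quotient,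
    ← Nat.cast_inj (R := ℕ∞), ENat.natCast_toNat (h.coheight_lt_top hI m).ne,
    ENat.natCast_toNat (h.coheight_lt_top hI n).ne] at heq
  by_contra hne
  exact (Order.coheight_strictAnti (lt_of_le_of_ne hmn hne) (h.coheight_lt_top hI m)).ne heq

/-- Equal finite colengths give `F m = F n ⊆ I k * F m`, so `F m = 0` by Nakayama. As `F m` contains
a power of the maximal ideal, `R` is Artinian. -/
theorem IsFiltration.ringKrullDim_eq_zero (h : IsFiltration I F) (hI : ∀ i, IsMaxPrimary (I i))
    {m n : Fin s → ℤ} (k : Fin s) (hmn : F n ≤ I k * F m) (hle : F n ≤ F m)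
    (heq : hilbertFunction F m = hilbertFunction F n) : ringKrullDim R = 0 := by
  have hbot : F m = ⊥ := by
    refine Submodule.eq_bot_of_le_smul_of_le_jacobson_bot (maximalIdeal R) _
      (IsNoetherian.noetherian _) ?_ (IsLocalRing.maximalIdeal_le_jacobson _)
    calc F m = F n := (h.eq_of_hilbertFunction_eq hI hle heq).symm
      _ ≤ I k * F m := hmn
      _ ≤ maximalIdeal R * F m := Ideal.mul_mono_left (hI k).le_maximalIdeal
  obtain ⟨e, he⟩ := exists_pow_le_mpow hI m
  have : IsArtinianRing R := (isArtinianRing_iff_isNilpotent_maximalIdeal R).2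
    ⟨e, le_bot_iff.1 ((he.trans (h.mpow_le m)).trans hbot.le)⟩
  exact ringKrullDimZero_iff_ringKrullDim_eq_zero.1 inferInstance

end Length

/-- The restriction of `P` to the coordinate plane through `n` in the directions `i` and `j`. -/
noncomputable def planeRestriction (P : MvPolynomial (Fin s) ℚ) (n : Fin s → ℤ) (i j : Fin s) :
    Polynomial (Polynomial ℚ) :=
  MvPolynomial.eval₂Hom (Polynomial.C.comp Polynomial.C) (Function.update (Function.update
    (fun k => Polynomial.C (Polynomial.C (n k : ℚ))) i (Polynomial.C Polynomial.X))
      j Polynomial.X) P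

theorem eval_planeRestriction (P : MvPolynomial (Fin s) ℚ) (n : Fin s → ℤ) (i j : Fin s)
    (x t : ℤ) :
    ((planeRestriction P n i j).map (Polynomial.evalRingHom (x : ℚ))).eval (t : ℚ) =
      MvPolynomial.eval (fun k => ((Function.update (Function.update n i x) j t k : ℤ) : ℚ)) P := by
  change (((Polynomial.evalRingHom (t : ℚ)).comp (Polynomial.mapRingHom
    (Polynomial.evalRingHom (x : ℚ)))).comp (MvPolynomial.eval₂Hom _ _)) P = _
  refine congrArg (fun f : MvPolynomial (Fin s) ℚ →+* ℚ => f P) (MvPolynomial.ringHom_ext ?_ ?_)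
  · intro a
    simp
  · intro k
    rcases eq_or_ne k j with rfl | hj
    · simp
    · rcases eq_or_ne k i with rfl | hi
      · simp [hj]
      · simp [hj, hi]

end MultiFiltration

/-! ### Restriction to a coordinate plane and the contradiction. -/

open MultiFiltration in
theorem proposition3p8 {R : Type*} [CommRing R] [IsLocalRing R] [IsNoetherianRing R]
    [Infinite (IsLocalRing.ResidueField R)]
    (d : ℕ) (hdim : ringKrullDim R = d) (hd : 1 ≤ d)
    (s : ℕ) (hs : 2 ≤ s)
    (I : Fin s → Ideal R) (hI : ∀ i, MultiFiltration.IsMaxPrimary (I i))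
    (F : (Fin s → ℤ) → Ideal R) (hF : MultiFiltration.IsAdmissible I F) :
    MultiFiltration.postulationVectors F ⊆ {n : Fin s → ℤ | ∀ i, 0 ≤ n i} := by
  rintro n ⟨P, -, hP⟩ i
  by_contra! hi
  have : Nontrivial (Fin s) := Fin.nontrivial_iff_two_le.2 hs
  obtain ⟨j, hji⟩ := exists_ne i
  have hfil := hF.toIsFiltration
  obtain ⟨r, hr⟩ := hF.exists_le_pow_mul
  obtain ⟨a, ha⟩ := (hI i).exists_pow_le_of_isMaxPrimary (hI j)
  obtain ⟨b, hb⟩ := (hI j).exists_pow_le_of_isMaxPrimary (hI i)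
  let v : ℤ → ℤ → Fin s → ℤ := fun x t => Function.update (Function.update n i x) j t
  have vi (x t : ℤ) : v x t i = x := by simp [v, hji.symm]
  have vj (x t : ℤ) : v x t j = t := by simp [v]
  have addi (x y t : ℤ) : v x t + Pi.single i y = v (x + y) t := by
    ext k
    by_cases hk : k = i <;> by_cases hk' : k = j <;> simp_all [v]
  have addj (x t u : ℤ) : v x t + Pi.single j u = v x (t + u) := by
    ext k
    by_cases hk : k = i <;> by_cases hk' : k = j <;> simp_all [v]
  -- `t ≥ N` keeps `v x t` above `n` for `x ≥ -1` and allows absorption in direction `j`.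
  set N : ℕ := max r (n j).toNat with hN
  have hH (x t : ℤ) (hx : -1 ≤ x) (ht : (N : ℤ) ≤ t) :
      ((planeRestriction P n i j).map (Polynomial.evalRingHom (x : ℚ))).eval (t : ℚ) =
        (hilbertFunction F (v x t) : ℚ) := by
    rw [eval_planeRestriction, hP]
    intro k
    by_cases hk : k = i <;> by_cases hk' : k = j <;> simp_all [v] <;> omega
  have hconst := Polynomial.natDegree_eq_zero_of_growth (Q := planeRestriction P n i j)
    (N := N) (a := a) (b := b) (r := r) ?_ ?_ ?_ ?_
  · have hHN : hilbertFunction F (v 0 N) = hilbertFunction F (v 0 (N + 1)) := by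
      have h1 := hH 0 N (by omega) (by omega)
      have h2 := hH 0 (N + 1) (by omega) (by omega)
      rw [Int.cast_zero, Polynomial.eq_C_of_natDegree_eq_zero hconst, Polynomial.eval_C] at h1 h2
      exact_mod_cast h1.symm.trans h2
    have hle := hr j (v 0 N) (by rw [vj]; omega) 1
    rw [Nat.cast_one, addj, pow_one] at hle
    have := hfil.ringKrullDim_eq_zero hI j hle (hle.trans Ideal.mul_le_right) hHN
    rw [hdim] at this
    norm_cast at this
    omega
  · intro t ht
    have h1 := hH (-1) t (by omega) (by omega)
    have h2 := hH 0 t (by omega) (by omega)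
    have : F (v (-1) t) = F (v 0 t) := by
      rw [hF.eq_pos, hF.eq_pos (v 0 t)]
      congr 1
      ext k
      by_cases hk : k = i <;> by_cases hk' : k = j <;> simp_all [v]
    rw [hilbertFunction, this, ← hilbertFunction] at h1
    push_cast at h1 h2
    rw [h1, h2]
  · intro x t ht
    have := hH x t (by omega) (by omega)
    push_cast at this
    rw [this]
    positivity
  · intro x t ht
    have h1 := hH x t (by omega) (by omega)
    have h2 := hH 0 (t + b * x : ℕ) (by omega) (by push_cast; nlinarith)
    push_cast at h1 h2 ⊢
    rw [h1, h2, Nat.cast_le]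
    refine hfil.hilbertFunction_mono hI ?_
    calc F (v 0 (t + b * x))
        = F (v 0 t + Pi.single j ((b * x : ℕ) : ℤ)) := by rw [addj]; push_cast; rfl
      _ ≤ I j ^ (b * x) * F (v 0 t) := hr j _ (by rw [vj]; omega) _
      _ ≤ I i ^ x * F (v 0 t) := by
        rw [pow_mul]
        exact Ideal.mul_mono_left (Ideal.pow_right_mono hb x)
      _ ≤ F (v 0 t + Pi.single i (x : ℤ)) := hfil.pow_mul_le _ _ _
      _ = F (v x t) := by rw [addi, zero_add]
  -- The base is `x = r`, where absorption in direction `i` begins.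
  · intro t ht
    have h1 := hH r (t + 1) (by omega) (by omega)
    have h2 := hH (r + a) t (by omega) (by omega)
    push_cast at h1 h2 ⊢
    rw [h1, h2, Nat.cast_le]
    refine hfil.hilbertFunction_mono hI ?_
    calc F (v (r + a) t)
        = F (v r t + Pi.single i (a : ℤ)) := by rw [addi]
      _ ≤ I i ^ a * F (v r t) := hr i _ (by rw [vi]) _
      _ ≤ I j ^ 1 * F (v r t) := by
        rw [pow_one]
        exact Ideal.mul_mono_left ha
      _ ≤ F (v r t + Pi.single j ((1 : ℕ) : ℤ)) := hfil.pow_mul_le _ _ _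
      _ = F (v r (t + 1)) := by rw [addj]; rfl
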